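/- Let $G$ be a group, and let $X(G)=\langle G, G^\psi \mid [g,g^\psi],\ g\in G\rangle$ be its Sidki double, that is, the quotient of the free product $G * G^\psi$ of $G$ with an isomorphic copy $G^\psi$ of $G$ (where $g\mapsto g^\psi$ denotes the isomorphism) by the normal closure of the commutators $[g,g^\psi]=g^{-1}(g^\psi)^{-1}g\,g^\psi$, $g\in G$. Assume that $X(G)$ is torsion-free, i.e. that its only element of finite order is the identity. If the complex group ring $\mathbb{C}(G\times G\times G)$ has no idempotents other than $0$ and $1$, then the complex group ring $\mathbb{C}X(G)$ has no idempotents other than $0$ and $1$. -/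

import Mathlib

/-- The defining relators of the Sidki double of `G`: the commutators
`[g, g^ψ] = g⁻¹ (g^ψ)⁻¹ g g^ψ`, `g ∈ G`, in the free product `G * G^ψ`. Here `G^ψ` is a second copy
of `G`; `Monoid.Coprod.inl g` is the element `g` of the first copy and `Monoid.Coprod.inr g` is the
element `g^ψ` of the second copy. -/
def sidkiRelators (G : Type*) [Group G] : Set (Monoid.Coprod G G) :=
  Set.range fun g : G =>
    (Monoid.Coprod.inl g : Monoid.Coprod G G)⁻¹ * (Monoid.Coprod.inr g)⁻¹ *
      Monoid.Coprod.inl g * Monoid.Coprod.inr g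

/-- The Sidki double `X(G) = ⟨G, G^ψ | [g, g^ψ], g ∈ G⟩`: the quotient of the free product of two
copies of `G` by the normal closure of the commutators `[g, g^ψ]`. -/
abbrev SidkiDouble (G : Type*) [Group G] : Type _ :=
  Monoid.Coprod G G ⧸ Subgroup.normalClosure (sidkiRelators G)

/-- A group is torsion-free if its only element of finite order is the identity. (For groups that
are not commutative this is weaker than injectivity of all the power maps `x ↦ x ^ n`, `n ≠ 0`.) -/
def IsTorsionFreeGroup (H : Type*) [Group H] : Prop :=
  ∀ x : H, IsOfFinOrder x → x = 1

/-- Every idempotent of the ring `R` is trivial, that is, equal to `0` or `1`. -/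
def HasOnlyTrivialIdempotents (R : Type*) [Ring R] : Prop :=
  ∀ e : R, IsIdempotentElem e → e = 0 ∨ e = 1

/-! Send `X(G)` to `G × G × G` by the two projections and the folding map. The kernel `N` is
abelian: commutators `[g, h^ψ]` generate a normal subgroup containing the common kernel of the
projections, and every `h^ψ h⁻¹` centralizes it, hence so does the kernel of the folding map. An
idempotent `e` of `ℂX(G)` maps to `0` or `1`, so it suffices that the kernel `I` of the map of group
rings contains no idempotent but `0`. Such an `e` lies in every `Iⁿ`, so it is killed by all
functions polynomial along `N`; as `N` is torsion-free abelian, these detect each coefficient of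
`e`. -/

/-- Finitely many nonzero elements of a torsion-free abelian group are simultaneously not killed by
some additive map to `ℚ`. -/
theorem exists_addMonoidHom_rat_forall_ne_zero {A : Type*} [AddCommGroup A] [IsAddTorsionFree A]
    (S : Finset A) (hS : ∀ a ∈ S, a ≠ 0) : ∃ φ : A →+ ℚ, ∀ a ∈ S, φ a ≠ 0 := by
  -- `A` embeds in its divisible hull, a `ℚ`-vector space, where one functional avoids finitely many
  -- zeros.
  obtain ⟨l, hl⟩ := Module.exists_dual_forall_apply_ne_zero (K := ℚ)
    (fun a : S => ((a : A) : DivisibleHull A)) (fun a h =>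
      hS a a.2 (DivisibleHull.coe_injective (h.trans (DivisibleHull.coeAddMonoidHom A).map_zero.symm)))
  exact ⟨l.toAddMonoidHom.comp (DivisibleHull.coeAddMonoidHom A), fun a ha => hl ⟨a, ha⟩⟩

theorem Subgroup.exists_rat_forall_ne_zero {H : Type*} [Group H] (N : Subgroup H)
    (hcomm : ∀ a ∈ N, ∀ b ∈ N, a * b = b * a) (htf : ∀ a ∈ N, IsOfFinOrder a → a = 1)
    (S : Finset N) (hS : ∀ a ∈ S, a ≠ 1) :
    ∃ φ : N → ℚ, (∀ a b, φ (a * b) = φ a + φ b) ∧ ∀ a ∈ S, φ a ≠ 0 := by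
  let _ : CommGroup N :=
    { (inferInstance : Group N) with
      mul_comm := fun a b => Subtype.ext (hcomm a a.2 b b.2) }
  have : IsMulTorsionFree N := IsMulTorsionFree.of_not_isOfFinOrder fun a ha hfin =>
    ha (Subtype.ext (htf a a.2 (Submonoid.isOfFinOrder_coe.2 hfin)))
  obtain ⟨φ, hφ⟩ := exists_addMonoidHom_rat_forall_ne_zero
    (A := Additive N) (S.map Additive.ofMul.toEmbedding) (by
      intro a ha h
      rw [Finset.mem_map] at ha
      obtain ⟨b, hb, rfl⟩ := ha
      exact hS b hb h)
  exact ⟨fun a => φ (Additive.ofMul a), fun a b => φ.map_add _ _,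
    fun a ha => hφ _ (Finset.mem_map_of_mem _ ha)⟩

/-! ### Polynomial functions along a subgroup and idempotents -/

/-- The function `u` on a group is polynomial of degree less than `n` along left translations by
the subgroup `N`: its `n`-fold iterated differences vanish. -/
def Subgroup.DegreeLT {H k : Type*} [Group H] [Ring k] (N : Subgroup H) : ℕ → (H → k) → Prop
  | 0, u => u = 0
  | n + 1, u => ∀ w ∈ N, N.DegreeLT n (fun x => u (w * x) - u x)

namespace MonoidAlgebra

/-- The linear functional on a group algebra that extends a function on the group. -/
noncomputable def functional {H k : Type*} [Field k] (u : H → k) : MonoidAlgebra k H →+ k :=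
  (Finsupp.linearCombination k u).toAddMonoidHom.comp coeffAddEquiv.toAddMonoidHom

@[simp]
theorem functional_single {H k : Type*} [Field k] (u : H → k) (x : H) (c : k) : functional u (single x c) = c * u x := by
  simp [functional]

theorem functional_zero {H k : Type*} [Field k] (a : MonoidAlgebra k H) : functional (0 : H → k) a = 0 := by
  induction a using MonoidAlgebra.induction_linear with
  | zero => simp
  | add a b ha hb => simp [ha, hb]
  | single x c => simp

variable {H Q k : Type*} [Group H] [Group Q] [Field k]

/-- Left multiplication by `w - 1` is adjoint to the difference operator along `w`. -/
theorem functional_sub_one_mul (u : H → k) (w y : H) (c : k) (a : MonoidAlgebra k H) :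
    functional u ((single (w * y) c - single y c) * a) =
      c * functional (fun x => u (w * x) - u x) (single y 1 * a) := by
  induction a using MonoidAlgebra.induction_linear with
  | zero => simp
  | add a b ha hb => simp only [mul_add, map_add, ha, hb]
  | single x d =>
    simp only [sub_mul, single_mul_single, map_sub, functional_single, mul_assoc]
    ring

/-- If `a` lies in the kernel of `k[H] → k[Q]`, then `a * b` is killed by the functional of `u` as
soon as all translates of `b` are killed by the differences of `u` along the kernel of `H → Q`. -/
theorem functional_mul_eq_zero_of_mapDomain_eq_zero (f : H →* Q) (u : H → k)
    (a b : MonoidAlgebra k H) (ha : mapDomain f a = 0)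
    (h : ∀ w ∈ f.ker, ∀ y, functional (fun x => u (w * x) - u x) (single y 1 * b) = 0) :
    functional u (a * b) = 0 := by
  -- Moving each `x` to the chosen representative of its fibre over `f x` does not change the
  -- functional, and the result depends only on the image of `a`.
  have key : ∀ a : MonoidAlgebra k H, functional u (a * b) =
      functional u (mapDomain (Function.invFun f) (mapDomain f a) * b) := by
    intro a
    induction a using MonoidAlgebra.induction_linear with
    | zero => simp
    | add a b ha hb => simp only [mapDomain_add, add_mul, map_add, ha, hb]
    | single x c =>
      simp only [mapDomain_single]
      set y := Function.invFun f (f x) with hy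
      have hfy : f y = f x := Function.invFun_eq ⟨x, rfl⟩
      have hw : x * y⁻¹ ∈ f.ker := by simp [MonoidHom.mem_ker, hfy]
      have := functional_sub_one_mul u (x * y⁻¹) y c b
      rw [h _ hw, mul_zero, inv_mul_cancel_right, sub_mul, map_sub, sub_eq_zero] at this
      exact this
  rw [key, ha]
  simp

/-- An idempotent of the kernel of `k[H] → k[Q]` is killed by the functionals that come from
functions of finite degree along the kernel of `H → Q`. -/
theorem functional_mul_eq_zero_of_isIdempotentElem (f : H →* Q) {e : MonoidAlgebra k H}
    (he : IsIdempotentElem e) (hfe : mapDomain f e = 0) (n : ℕ) :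
    ∀ u : H → k, f.ker.DegreeLT n u → ∀ y, functional u (single y 1 * e) = 0 := by
  induction n with
  | zero =>
    rintro u rfl y
    exact functional_zero _
  | succ n ih =>
    intro u hu y
    -- Each extra factor `e` lowers the degree by one.
    rw [← he.eq, ← mul_assoc]
    refine functional_mul_eq_zero_of_mapDomain_eq_zero f u _ _ ?_ fun w hw z => ih _ (hu w hw) z
    rw [mapDomain_mul, hfe, mul_zero]

end MonoidAlgebra

open Classical in
/-- A polynomial in an additive function on `N`, extended by zero from the coset `N x₀`. -/
noncomputable def Subgroup.cosetPolynomial {H k : Type*} [Group H] [Field k] (N : Subgroup H)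
    (φ : N → k) (x₀ : H) (p : Polynomial k) (x : H) : k :=
  if h : x * x₀⁻¹ ∈ N then p.eval (φ ⟨x * x₀⁻¹, h⟩) else 0

/-- Translation by `w` preserves the coset and turns `p` into its Taylor shift by `φ w`, which has
the same leading term. -/
theorem Subgroup.degreeLT_cosetPolynomial {H k : Type*} [Group H] [Field k] (N : Subgroup H)
    (φ : N → k) (hφ : ∀ a b, φ (a * b) = φ a + φ b) (x₀ : H) (n : ℕ) :
    ∀ p : Polynomial k, p.degree < n → N.DegreeLT n (N.cosetPolynomial φ x₀ p) := by
  induction n with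
  | zero =>
    intro p hp
    have : p = 0 := by simpa using hp
    funext x
    simp [cosetPolynomial, this]
  | succ n ih =>
    intro p hp w hw
    have hdiff : (fun x => N.cosetPolynomial φ x₀ p (w * x) - N.cosetPolynomial φ x₀ p x) =
        N.cosetPolynomial φ x₀ (Polynomial.taylor (φ ⟨w, hw⟩) p - p) := by
      funext x
      by_cases hx : x * x₀⁻¹ ∈ N
      · have hwx : w * x * x₀⁻¹ ∈ N := by rw [mul_assoc]; exact N.mul_mem hw hx
        have hval : φ ⟨w * x * x₀⁻¹, hwx⟩ = φ ⟨w, hw⟩ + φ ⟨x * x₀⁻¹, hx⟩ := by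
          rw [← hφ]
          congr 1
          exact Subtype.ext (mul_assoc _ _ _)
        simp [cosetPolynomial, hx, hwx, hval, Polynomial.taylor_eval, add_comm]
      · have hwx : w * x * x₀⁻¹ ∉ N := by rwa [mul_assoc, N.mul_mem_cancel_left hw]
        simp [cosetPolynomial, hx, hwx]
    rw [hdiff]
    apply ih
    by_cases hp0 : p = 0
    · simp [hp0]
    · have h1 := Polynomial.degree_sub_lt_left (p := Polynomial.taylor (φ ⟨w, hw⟩) p) (q := p)
        (Polynomial.degree_taylor _ _) ((Polynomial.taylor_eq_zero _ _).not.2 hp0)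
        (Polynomial.leadingCoeff_taylor _ _)
      rw [Polynomial.degree_taylor] at h1
      refine lt_of_lt_of_le h1 ?_
      exact Polynomial.degree_le_of_natDegree_le
        (Nat.lt_succ_iff.1 ((Polynomial.natDegree_lt_iff_degree_lt hp0).2 hp))

/-- If the kernel of `f : H →* Q` is abelian and torsion-free, then the kernel of `k[H] → k[Q]`
contains no nonzero idempotent. -/
theorem MonoidAlgebra.eq_zero_of_isIdempotentElem_of_mapDomain_eq_zero {H Q k : Type*} [Group H]
    [Group Q] [Field k] [CharZero k] (f : H →* Q)
    (hcomm : ∀ a ∈ f.ker, ∀ b ∈ f.ker, a * b = b * a) (htf : ∀ a ∈ f.ker, IsOfFinOrder a → a = 1)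
    {e : MonoidAlgebra k H} (he : IsIdempotentElem e) (hfe : mapDomain f e = 0) : e = 0 := by
  classical
  ext x₀
  let S : Finset f.ker := ((e.coeff.support.image (· * x₀⁻¹)).subtype (· ∈ f.ker)).erase 1
  obtain ⟨φ, hφ, hne⟩ := f.ker.exists_rat_forall_ne_zero hcomm htf S
    (fun a ha => Finset.ne_of_mem_erase ha)
  have hφ1 : φ 1 = 0 := by simpa using hφ 1 1
  let ψ : f.ker → k := fun a => (φ a : k)
  -- `p` vanishes at all other support points of the coset of `x₀` but not at `ψ 1 = 0`, so its
  -- functional isolates the coefficient of `x₀`.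
  let p : Polynomial k := ∏ a ∈ S, (Polynomial.X - Polynomial.C (ψ a))
  have hp1 : p.eval (ψ 1) ≠ 0 := by
    rw [Polynomial.eval_prod, Finset.prod_ne_zero_iff]
    intro a ha
    simpa [ψ, hφ1] using hne a ha
  have hp : ∀ a ∈ S, p.eval (ψ a) = 0 := by
    intro a ha
    rw [Polynomial.eval_prod]
    exact Finset.prod_eq_zero ha (by simp)
  have hdeg := f.ker.degreeLT_cosetPolynomial ψ (fun a b => by simp [ψ, hφ]) x₀ (p.natDegree + 1) p
    (Polynomial.degree_le_natDegree.trans_lt (by exact_mod_cast Nat.lt_succ_self _))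
  have h0 := functional_mul_eq_zero_of_isIdempotentElem f he hfe _ _ hdeg 1
  have hsum : functional (f.ker.cosetPolynomial ψ x₀ p) e = e.coeff x₀ * p.eval (ψ 1) := by
    change Finsupp.linearCombination k _ e.coeff = _
    rw [Finsupp.linearCombination_apply, Finsupp.sum, Finset.sum_eq_single x₀]
    · have : (⟨x₀ * x₀⁻¹, by simp⟩ : f.ker) = 1 := Subtype.ext (mul_inv_cancel x₀)
      rw [Subgroup.cosetPolynomial, dif_pos (by simp), this, smul_eq_mul]
    · intro x hx hxx
      rw [Subgroup.cosetPolynomial]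
      split_ifs with h
      · rw [hp, smul_zero]
        rw [Finset.mem_erase, Finset.mem_subtype]
        exact ⟨fun h1 => hxx (mul_inv_eq_one.1 (congrArg Subtype.val h1)),
          Finset.mem_image_of_mem _ hx⟩
      · rw [smul_zero]
    · intro hx
      rw [Finsupp.notMem_support_iff.1 hx, zero_smul]
  rw [← one_def, one_mul, hsum] at h0
  simpa [hp1] using h0

/-! ### Commutators between two commuting copies of a group -/

/-- The commutator `g⁻¹ k⁻¹ g k`. -/
def rightCommutator {X : Type*} [Group X] (g k : X) : X := g⁻¹ * k⁻¹ * g * k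

theorem rightCommutator_mul_left {X : Type*} [Group X] (g h k : X) :
    rightCommutator (g * h) k = h⁻¹ * rightCommutator g k * h * rightCommutator h k := by
  simp only [rightCommutator]
  group

section CommutingTwins

variable {X G : Type*} [Group X] [Group G] {i j : G →* X}

/-- This is the relation for the product `g * h`, simplified by those for `g` and `h`. -/
theorem rightCommutator_eq_of_commute (hij : ∀ g, Commute (i g) (j g)) (g h : G) :
    rightCommutator (i g) (j h) = rightCommutator (j g) (i h) := by
  have key : ∀ h, (j g)⁻¹ * i h * j g * (i h)⁻¹ = (i g)⁻¹ * j h * i g * (j h)⁻¹ := by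
    intro h
    have h1 := (hij (g * h)).eq
    simp only [map_mul] at h1
    have h2 := (hij g).eq
    have h3 := (hij h).inv_left.eq
    calc (j g)⁻¹ * i h * j g * (i h)⁻¹
        = (i g)⁻¹ * (j g)⁻¹ * (j g * i g * (j g)⁻¹) * i h * j g * ((i h)⁻¹ * j h) * (j h)⁻¹ := by
          group
      _ = (i g)⁻¹ * (j g)⁻¹ * (i g * i h * (j g * j h)) * (i h)⁻¹ * (j h)⁻¹ := by
          rw [← h2, h3]; group
      _ = (i g)⁻¹ * j h * i g * (j h)⁻¹ := by
          rw [h1]; group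
  -- `key` concerns commutators with the inverse of `h`.
  have := key h⁻¹
  simp only [map_inv, inv_inv] at this
  exact this.symm

/-- Expand both sides of `[gh, k^ψ] = [(gh)^ψ, k]` by the product rule and cancel `[h, k^ψ]`. -/
theorem conj_rightCommutator_eq_of_commute (hij : ∀ g, Commute (i g) (j g)) (g h k : G) :
    (i h)⁻¹ * rightCommutator (i g) (j k) * i h = (j h)⁻¹ * rightCommutator (i g) (j k) * j h := by
  have h1 := rightCommutator_eq_of_commute hij (g * h) k
  rw [map_mul, map_mul, rightCommutator_mul_left, rightCommutator_mul_left,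
    ← rightCommutator_eq_of_commute hij h k, ← rightCommutator_eq_of_commute hij g k] at h1
  exact mul_right_cancel h1

/-- The subgroup generated by the commutators of the elements of two copies of a group. -/
def crossCommutator (i j : G →* X) : Subgroup X :=
  Subgroup.closure (Set.range fun p : G × G => rightCommutator (i p.1) (j p.2))

theorem rightCommutator_mem_crossCommutator (g k : G) :
    rightCommutator (i g) (j k) ∈ crossCommutator i j :=
  Subgroup.subset_closure ⟨(g, k), rfl⟩

theorem conj_mem_crossCommutator (h : G) {x : X} (hx : x ∈ crossCommutator i j) :
    (i h)⁻¹ * x * i h ∈ crossCommutator i j := by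
  have hle : crossCommutator i j ≤ (crossCommutator i j).comap (MulAut.conj (i h)⁻¹).toMonoidHom := by
    rw [crossCommutator, Subgroup.closure_le]
    rintro _ ⟨⟨g, k⟩, rfl⟩
    -- The product rule gives the conjugate of `[g, k^ψ]` by `h` as `[gh, k^ψ] [h, k^ψ]⁻¹`.
    have h1 := rightCommutator_mul_left (i g) (i h) (j k)
    rw [← map_mul, ← mul_inv_eq_iff_eq_mul] at h1
    have h2 : (i h)⁻¹ * rightCommutator (i g) (j k) * i h ∈ crossCommutator i j := by
      rw [← h1]
      exact mul_mem (rightCommutator_mem_crossCommutator _ _)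
        (inv_mem (rightCommutator_mem_crossCommutator _ _))
    simpa [crossCommutator] using h2
  simpa using hle hx

theorem commute_of_mem_crossCommutator (hij : ∀ g, Commute (i g) (j g)) (h : G) {x : X}
    (hx : x ∈ crossCommutator i j) : Commute (j h * (i h)⁻¹) x := by
  have hle : crossCommutator i j ≤ Subgroup.centralizer {j h * (i h)⁻¹} := by
    rw [crossCommutator, Subgroup.closure_le]
    rintro _ ⟨⟨g, k⟩, rfl⟩
    have := conj_rightCommutator_eq_of_commute hij g h k
    rw [SetLike.mem_coe, Subgroup.mem_centralizer_singleton_iff]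
    change rightCommutator (i g) (j k) * (j h * (i h)⁻¹) = j h * (i h)⁻¹ * rightCommutator (i g) (j k)
    set c := rightCommutator (i g) (j k)
    symm
    calc (j h * (i h)⁻¹) * c = j h * ((i h)⁻¹ * c * i h) * (i h)⁻¹ := by group
      _ = c * (j h * (i h)⁻¹) := by rw [this]; group
  exact (Subgroup.mem_centralizer_singleton_iff.1 (hle hx)).symm

/-- Since `j h * (i h)⁻¹` centralizes the subgroup, conjugation by `j h` acts on it as conjugation
by `i h`. -/
theorem crossCommutator_normal (hij : ∀ g, Commute (i g) (j g)) (htop : i.range ⊔ j.range = ⊤) :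
    (crossCommutator i j).Normal := by
  have hi : ∀ h : G, ∀ x ∈ crossCommutator i j, i h * x * (i h)⁻¹ ∈ crossCommutator i j := by
    intro h x hx
    simpa using conj_mem_crossCommutator (j := j) h⁻¹ hx
  have hj : ∀ h : G, ∀ x ∈ crossCommutator i j, j h * x * (j h)⁻¹ ∈ crossCommutator i j := by
    intro h x hx
    have h1 := hi h x hx
    have h2 := (commute_of_mem_crossCommutator hij h h1).eq
    convert h1 using 1
    calc j h * x * (j h)⁻¹
        = (j h * (i h)⁻¹) * (i h * x * (i h)⁻¹) * (j h * (i h)⁻¹)⁻¹ := by group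
      _ = i h * x * (i h)⁻¹ := by rw [h2]; group
  rw [← Subgroup.normalizer_eq_top_iff, eq_top_iff, ← htop, sup_le_iff]
  constructor
  · rintro _ ⟨h, rfl⟩
    refine Subgroup.mem_normalizer_iff.2 fun x => ⟨hi h x, fun hx => ?_⟩
    have := hi h⁻¹ _ hx
    simpa [mul_assoc] using this
  · rintro _ ⟨h, rfl⟩
    refine Subgroup.mem_normalizer_iff.2 fun x => ⟨hj h x, fun hx => ?_⟩
    have := hj h⁻¹ _ hx
    simpa [mul_assoc] using this

/-- A homomorphism restricting to the identity on both copies has its kernel in every normal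
subgroup that identifies the two copies. -/
theorem ker_le_of_identifies (htop : i.range ⊔ j.range = ⊤) (m : X →* G)
    (hmi : ∀ g, m (i g) = g) (hmj : ∀ g, m (j g) = g) (N : Subgroup X) [N.Normal]
    (hN : ∀ g, j g * (i g)⁻¹ ∈ N) : m.ker ≤ N := by
  -- Modulo `N`, the identity and `i ∘ m` agree on generators.
  have hle : i.range ⊔ j.range ≤
      (QuotientGroup.mk' N).eqLocus ((QuotientGroup.mk' N).comp (i.comp m)) := by
    rw [sup_le_iff]
    constructor
    · rintro _ ⟨g, rfl⟩
      change QuotientGroup.mk' N _ = QuotientGroup.mk' N _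
      simp [hmi]
    · rintro _ ⟨g, rfl⟩
      change QuotientGroup.mk' N _ = QuotientGroup.mk' N _
      rw [← mul_inv_eq_one, ← map_inv, ← map_mul]
      exact (QuotientGroup.eq_one_iff _).2 (by simpa [hmj] using hN g)
  intro x hx
  have h1 : QuotientGroup.mk' N x = QuotientGroup.mk' N (i (m x)) :=
    hle (htop ▸ Subgroup.mem_top x)
  rw [MonoidHom.mem_ker.1 hx, map_one, map_one] at h1
  simpa using h1

/-- The common kernel of the projections to the two copies lies in every normal subgroup modulo
which the two copies commute. -/
theorem ker_inf_ker_le_of_rightCommutator_mem (htop : i.range ⊔ j.range = ⊤) (p q : X →* G)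
    (hpi : ∀ g, p (i g) = g) (hpj : ∀ g, p (j g) = 1) (hqi : ∀ g, q (i g) = 1)
    (hqj : ∀ g, q (j g) = g) (N : Subgroup X) [N.Normal]
    (hN : ∀ g k, rightCommutator (i g) (j k) ∈ N) : p.ker ⊓ q.ker ≤ N := by
  let π := QuotientGroup.mk' N
  have hcomm : ∀ g k, Commute ((π.comp i) g) ((π.comp j) k) := by
    intro g k
    have h1 : π (rightCommutator (i g) (j k)) = 1 := by simpa [π] using hN g k
    simp only [rightCommutator, map_mul, map_inv] at h1
    rw [mul_assoc, ← mul_inv_rev, inv_mul_eq_one] at h1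
    exact h1.symm
  -- Since the copies commute modulo `N`, the quotient map factors through `(p, q)`.
  let r : X →* X ⧸ N := ((π.comp i).noncommCoprod (π.comp j) hcomm).comp (p.prod q)
  have hr : ∀ x, r x = π (i (p x)) * π (j (q x)) := fun x => rfl
  have hle : i.range ⊔ j.range ≤ π.eqLocus r := by
    rw [sup_le_iff]
    constructor
    · rintro _ ⟨g, rfl⟩
      change π _ = r _
      simp [hr, hpi, hqi]
    · rintro _ ⟨g, rfl⟩
      change π _ = r _
      simp [hr, hpj, hqj]
  rintro x ⟨hxp, hxq⟩
  have h1 : π x = r x := hle (htop ▸ Subgroup.mem_top x)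
  rw [hr, MonoidHom.mem_ker.1 hxp, MonoidHom.mem_ker.1 hxq] at h1
  simpa [π] using h1

/-- The common kernel of the two projections and of the folding map is abelian. -/
theorem mul_comm_of_mem_ker_of_commute (hij : ∀ g, Commute (i g) (j g))
    (htop : i.range ⊔ j.range = ⊤) (p q m : X →* G)
    (hpi : ∀ g, p (i g) = g) (hpj : ∀ g, p (j g) = 1) (hqi : ∀ g, q (i g) = 1)
    (hqj : ∀ g, q (j g) = g) (hmi : ∀ g, m (i g) = g) (hmj : ∀ g, m (j g) = g) {x y : X}
    (hxp : p x = 1) (hxq : q x = 1) (hym : m y = 1) : x * y = y * x := by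
  have hD := crossCommutator_normal hij htop
  have hx : x ∈ crossCommutator i j :=
    ker_inf_ker_le_of_rightCommutator_mem htop p q hpi hpj hqi hqj _
      rightCommutator_mem_crossCommutator ⟨hxp, hxq⟩
  -- The centralizer of a normal subgroup is normal.
  have hy : y ∈ Subgroup.centralizer (crossCommutator i j : Set X) :=
    ker_le_of_identifies htop m hmi hmj _
      (fun g => Subgroup.mem_centralizer_iff.2 fun z hz =>
        (commute_of_mem_crossCommutator hij g hz).eq.symm) hym
  exact Subgroup.mem_centralizer_iff.1 hy x hx

end CommutingTwins

/-! ### The Sidki double and its map to the triple product -/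

namespace SidkiDouble

variable {G : Type*} [Group G]

/-- The first copy of `G` in its Sidki double. -/
def inl : G →* SidkiDouble G := (QuotientGroup.mk' _).comp Monoid.Coprod.inl

/-- The second copy of `G` in its Sidki double. -/
def inr : G →* SidkiDouble G := (QuotientGroup.mk' _).comp Monoid.Coprod.inr

theorem commute_inl_inr (g : G) : Commute (inl g : SidkiDouble G) (inr g) := by
  have h1 : (QuotientGroup.mk' (Subgroup.normalClosure (sidkiRelators G)))
      ((Monoid.Coprod.inl g : Monoid.Coprod G G)⁻¹ * (Monoid.Coprod.inr g)⁻¹ *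
        Monoid.Coprod.inl g * Monoid.Coprod.inr g) = 1 :=
    (QuotientGroup.eq_one_iff _).2 (Subgroup.subset_normalClosure ⟨g, rfl⟩)
  simp only [map_mul, map_inv] at h1
  rw [mul_assoc, ← mul_inv_rev, inv_mul_eq_one] at h1
  exact h1.symm

theorem range_inl_sup_range_inr :
    (inl : G →* SidkiDouble G).range ⊔ (inr : G →* SidkiDouble G).range = ⊤ := by
  rw [inl, inr, MonoidHom.range_comp, MonoidHom.range_comp, ← Subgroup.map_sup,
    Monoid.Coprod.range_inl_sup_range_inr, ← MonoidHom.range_eq_map]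
  exact MonoidHom.range_eq_top.2 (QuotientGroup.mk'_surjective _)

/-- The homomorphism out of the Sidki double given by two elementwise commuting homomorphisms. -/
def lift {P : Type*} [Group P] (a b : G →* P) (h : ∀ g, Commute (a g) (b g)) :
    SidkiDouble G →* P :=
  QuotientGroup.lift _ (Monoid.Coprod.lift a b) <| by
    intro x hx
    have hle : Subgroup.normalClosure (sidkiRelators G) ≤ (Monoid.Coprod.lift a b).ker := by
      refine Subgroup.normalClosure_le_normal ?_
      rintro _ ⟨g, rfl⟩
      rw [SetLike.mem_coe, MonoidHom.mem_ker]
      simp only [map_mul, map_inv, Monoid.Coprod.lift_apply_inl, Monoid.Coprod.lift_apply_inr]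
      rw [mul_assoc, ← mul_inv_rev, inv_mul_eq_one]
      exact (h g).eq.symm
    exact hle hx

@[simp]
theorem lift_inl {P : Type*} [Group P] (a b : G →* P) (h : ∀ g, Commute (a g) (b g)) (g : G) :
    lift a b h (inl g) = a g := rfl

@[simp]
theorem lift_inr {P : Type*} [Group P] (a b : G →* P) (h : ∀ g, Commute (a g) (b g)) (g : G) :
    lift a b h (inr g) = b g := rfl

/-- The homomorphism `g ↦ (g, g, 1)`, `g^ψ ↦ (1, g, g)`. -/
def toTriple : SidkiDouble G →* G × G × G :=
  (lift (.id G) 1 fun g => Commute.one_right g).prod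
    ((lift (.id G) (.id G) fun _ => Commute.refl _).prod (lift 1 (.id G) fun g => Commute.one_left g))

theorem mul_comm_of_mem_ker_toTriple {x y : SidkiDouble G} (hx : x ∈ (toTriple (G := G)).ker)
    (hy : y ∈ (toTriple (G := G)).ker) : x * y = y * x := by
  rw [MonoidHom.mem_ker, toTriple, MonoidHom.prod_apply, Prod.mk_eq_one, MonoidHom.prod_apply,
    Prod.mk_eq_one] at hx hy
  -- The outer coordinates are the projections, the middle one is the folding map.
  exact mul_comm_of_mem_ker_of_commute commute_inl_inr range_inl_sup_range_inr _ _ _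
    (fun _ => rfl) (fun _ => rfl) (fun _ => rfl) (fun _ => rfl) (fun _ => rfl) (fun _ => rfl)
    hx.1 hx.2.2 hy.2.1

end SidkiDouble

theorem mainTheorem1 (G : Type*) [Group G]
    (htf : IsTorsionFreeGroup (SidkiDouble G))
    (hidem : HasOnlyTrivialIdempotents (MonoidAlgebra ℂ (G × G × G))) :
    HasOnlyTrivialIdempotents (MonoidAlgebra ℂ (SidkiDouble G)) := by
  let F := MonoidAlgebra.mapDomainRingHom ℂ (SidkiDouble.toTriple (G := G))
  have key : ∀ e : MonoidAlgebra ℂ (SidkiDouble G), IsIdempotentElem e → F e = 0 → e = 0 := by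
    intro e he h
    refine MonoidAlgebra.eq_zero_of_isIdempotentElem_of_mapDomain_eq_zero
      (SidkiDouble.toTriple (G := G)) ?_ ?_ he h
    · exact fun _ ha _ hb => SidkiDouble.mul_comm_of_mem_ker_toTriple ha hb
    · exact fun a _ => htf a
  intro e he
  rcases hidem (F e) (he.map F) with h | h
  · exact Or.inl (key e he h)
  · have h1 : F (1 - e) = 0 := by rw [map_sub, map_one, h, sub_self]
    exact Or.inr (sub_eq_zero.1 (key (1 - e) he.one_sub h1)).symm
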